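/- Let $V$ be a finite-dimensional real vector space, and let $\mathcal{K}(V)$ be the set of nonempty convex compact subsets of $V$ with the Hausdorff metric $d_H$ induced by a norm on $V$ (its topology does not depend on the norm). A function $\phi:\mathcal{K}(V)\to\mathbb{C}$ is a valuation if $\phi(K_1\cup K_2)=\phi(K_1)+\phi(K_2)-\phi(K_1\cap K_2)$ for all $K_1,K_2\in\mathcal{K}(V)$ such that $K_1\cup K_2$ is convex; it is a continuous valuation if it is moreover continuous with respect to $d_H$. A valuation $\phi$ is polynomial of degree $d$ if for every $K\in\mathcal{K}(V)$ the function $x\mapsto\phi(K+x)$ is a (complex-valued) polynomial on $V$ of degree at most $d$, and polynomial if it is polynomial of degree $d$ for some $d\ge 0$. Let $CVal(V)$ be the complex vector space of continuous valuations on $V$, with the topology of uniform convergence on compact subsets of $\mathcal{K}(V)$, and let $PVal(V)\subset CVal(V)$ be the subspace of polynomial continuous valuations. Then $PVal(V)$ is dense in $CVal(V)$. -/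

import Mathlib

namespace ConvexBody

variable {V : Type*} [NormedAddCommGroup V] [NormedSpace ℝ V]

/-- Two convex bodies whose union is convex have a common point. -/
theorem inter_nonempty_of_convex_union (K L : ConvexBody V)
    (h : Convex ℝ ((K : Set V) ∪ L)) : ((K : Set V) ∩ L).Nonempty := by
  have hp := isPreconnected_closed_iff.1 h.isPreconnected (K : Set V) (L : Set V)
    K.isCompact.isClosed L.isCompact.isClosed subset_rfl
    (by simpa using K.nonempty.mono (by simp))
    (by simpa using L.nonempty.mono (by simp))
  exact hp.mono Set.inter_subset_right

/-- The union of two convex bodies, when it is convex. -/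
def union (K L : ConvexBody V) (h : Convex ℝ ((K : Set V) ∪ L)) : ConvexBody V where
  carrier := (K : Set V) ∪ L
  convex' := h
  isCompact' := K.isCompact.union L.isCompact
  nonempty' := K.nonempty.mono Set.subset_union_left

/-- The intersection of two convex bodies whose union is convex. -/
def inter (K L : ConvexBody V) (h : Convex ℝ ((K : Set V) ∪ L)) : ConvexBody V where
  carrier := (K : Set V) ∩ L
  convex' := K.convex.inter L.convex
  isCompact' := K.isCompact.inter L.isCompact
  nonempty' := inter_nonempty_of_convex_union K L h

/-- The translate `K + x` of a convex body. -/
def translate (K : ConvexBody V) (x : V) : ConvexBody V where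
  carrier := (fun y => y + x) '' (K : Set V)
  convex' := by simpa [add_comm] using K.convex.translate x
  isCompact' := K.isCompact.image (by fun_prop)
  nonempty' := K.nonempty.image _

end ConvexBody

/-- Finitely additive functionals on convex bodies (nonempty compact convex sets). -/
def IsValuation {V : Type*} [NormedAddCommGroup V] [NormedSpace ℝ V]
    (φ : ConvexBody V → ℂ) : Prop :=
  ∀ (K L : ConvexBody V) (h : Convex ℝ ((K : Set V) ∪ L)),
    φ (K.union L h) = φ K + φ L - φ (K.inter L h)

/-- `f : V → ℂ` is a complex-valued polynomial function of degree at most `d` on the real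
vector space `V`: a polynomial expression of total degree at most `d`, with complex
coefficients, in finitely many real linear functionals on `V`. -/
def IsPolynomialOfDegreeLE {V : Type*} [AddCommGroup V] [Module ℝ V]
    (d : ℕ) (f : V → ℂ) : Prop :=
  ∃ p : MvPolynomial (Module.Dual ℝ V) ℂ, p.totalDegree ≤ d ∧
    ∀ x : V, f x = MvPolynomial.eval (fun l : Module.Dual ℝ V => ((l x : ℝ) : ℂ)) p

/-- `φ` is polynomial of degree `d`: for every `K`, the function `x ↦ φ (K + x)` is a
polynomial of degree at most `d`, with the same `d` for all `K`. -/
def IsPolynomialValuationOfDegree {V : Type*} [NormedAddCommGroup V] [NormedSpace ℝ V]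
    (d : ℕ) (φ : ConvexBody V → ℂ) : Prop :=
  IsValuation φ ∧
    ∀ K : ConvexBody V, IsPolynomialOfDegreeLE d (fun x : V => φ (K.translate x))

/-- The space of continuous valuations on `V`, where convex bodies carry the Hausdorff metric.
As a subspace of `C(ConvexBody V, ℂ)` with the compact-open topology, it has the topology of
uniform convergence on compact sets of convex bodies. -/
def CVal (V : Type*) [NormedAddCommGroup V] [NormedSpace ℝ V] :
    Submodule ℂ C(ConvexBody V, ℂ) where
  carrier := {φ | IsValuation φ}
  add_mem' := by
    intro φ ψ hφ hψ K L h
    simp only [ContinuousMap.add_apply, hφ K L h, hψ K L h]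
    ring
  zero_mem' := by
    intro K L h
    simp
  smul_mem' := by
    intro c φ hφ K L h
    simp only [ContinuousMap.smul_apply, hφ K L h, smul_eq_mul]
    ring

/-- The subspace of polynomial continuous valuations (of any degree). -/
def PVal (V : Type*) [NormedAddCommGroup V] [NormedSpace ℝ V] :
    Submodule ℂ (CVal V) where
  carrier := {φ | ∃ d : ℕ, IsPolynomialValuationOfDegree d (φ : C(ConvexBody V, ℂ))}
  add_mem' := by
    rintro φ ψ ⟨d, -, hφ⟩ ⟨e, -, hψ⟩
    refine ⟨max d e, (φ + ψ).2, fun K => ?_⟩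
    obtain ⟨p, hp, hp'⟩ := hφ K
    obtain ⟨q, hq, hq'⟩ := hψ K
    refine ⟨p + q, (MvPolynomial.totalDegree_add p q).trans (max_le_max hp hq), fun x => ?_⟩
    rw [map_add, ← hp' x, ← hq' x]
    rfl
  zero_mem' := ⟨0, (0 : CVal V).2, fun K => ⟨0, by simp, fun x => by simp⟩⟩
  smul_mem' := by
    rintro c φ ⟨d, -, hφ⟩
    refine ⟨d, (c • φ).2, fun K => ?_⟩
    obtain ⟨p, hp, hp'⟩ := hφ K
    refine ⟨c • p, (MvPolynomial.totalDegree_smul_le c p).trans hp, fun x => ?_⟩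
    rw [MvPolynomial.smul_eval, ← hp' x]
    rfl

/-! The idea is to convolve with polynomials. If `Φ` is a continuous valuation vanishing on bodies
far from the origin, then `K ↦ ∫ p(x) Φ(K - x) dx` is a continuous valuation for every polynomial
`p`. Translating `K` by `y` replaces `p(x)` by `p(x + y)`, so the result is polynomial in `y`
(`weightedTranslates_mem_PVal`). On a compact family of bodies only a bounded set of `x`
contributes; there `p` can be taken uniformly close to a bump of integral one
(`exists_polynomialFunction_near`), and the convolution is then close to `Φ`.

A general `φ` is first replaced by such a `Φ` agreeing with it on a large ball. The map `K ↦ φ(K ∩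
B_r)`, with value `0` on the empty set, is a valuation, but may jump when `B_r` only touches `K`.
For each `K` this concerns a single radius, so averaging over `r` restores continuity
(`continuousAt_truncatedValue`, `cutoff`). -/

open MeasureTheory Metric Set Filter Topology

/-! ### Hausdorff metric: selection theorem, translations, truncation by balls. -/

namespace ConvexBody

variable {V : Type*} [NormedAddCommGroup V] [NormedSpace ℝ V]

theorem exists_dist_lt {K L : ConvexBody V} {r : ℝ} (h : dist K L < r) {x : V} (hx : x ∈ K) :
    ∃ y ∈ L, dist x y < r :=
  exists_dist_lt_of_hausdorffDist_lt (s := (K : Set V)) (t := (L : Set V)) hx h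
    hausdorffEDist_ne_top

theorem dist_le_of_forall_exists {K L : ConvexBody V} {r : ℝ} (hr : 0 ≤ r)
    (h₁ : ∀ x ∈ K, ∃ y ∈ L, dist x y ≤ r) (h₂ : ∀ x ∈ L, ∃ y ∈ K, dist x y ≤ r) :
    dist K L ≤ r :=
  hausdorffDist_le_of_mem_dist (s := (K : Set V)) (t := (L : Set V)) hr h₁ h₂

/-- A convex body as a nonempty compact set. -/
def toNonemptyCompacts (K : ConvexBody V) : TopologicalSpace.NonemptyCompacts V :=
  ⟨⟨K, K.isCompact⟩, K.nonempty⟩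

theorem isometry_toNonemptyCompacts : Isometry (toNonemptyCompacts (V := V)) :=
  Isometry.of_dist_eq fun _ _ => rfl

/-- Convexity survives Hausdorff limits: a convex combination of points of the limit is close to one
in a nearby convex body, hence to the limit, which is closed. -/
theorem isClosed_range_toNonemptyCompacts : IsClosed (range (toNonemptyCompacts (V := V))) := by
  refine isClosed_of_closure_subset fun A hA => ?_
  refine ⟨⟨A, ?_, A.isCompact, A.nonempty⟩, rfl⟩
  intro x hx y hy a b ha hb hab
  rw [← A.isCompact.isClosed.closure_eq, Metric.mem_closure_iff]
  intro ε hε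
  obtain ⟨_, ⟨K, rfl⟩, hK⟩ := Metric.mem_closure_iff.1 hA (ε / 2) (half_pos hε)
  have fin : hausdorffEDist (A : Set V) (K : Set V) ≠ ⊤ :=
    hausdorffEDist_ne_top_of_nonempty_of_bounded A.nonempty K.nonempty A.isCompact.isBounded
      K.isBounded
  have hK' : hausdorffDist (A : Set V) (K : Set V) < ε / 2 := hK
  obtain ⟨x', hx', hxx⟩ := exists_dist_lt_of_hausdorffDist_lt hx hK' fin
  obtain ⟨y', hy', hyy⟩ := exists_dist_lt_of_hausdorffDist_lt hy hK' fin
  obtain ⟨w, hw, hww⟩ := exists_dist_lt_of_hausdorffDist_lt'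
    (K.convex hx' hy' ha hb hab) hK' fin
  refine ⟨w, hw, ?_⟩
  have h1 : dist (a • x + b • y) (a • x' + b • y') ≤ ε / 2 := by
    calc _ ≤ dist (a • x) (a • x') + dist (b • y) (b • y') := dist_add_add_le _ _ _ _
      _ = a * dist x x' + b * dist y y' := by
        rw [dist_smul₀, dist_smul₀, Real.norm_of_nonneg ha, Real.norm_of_nonneg hb]
      _ ≤ a * (ε / 2) + b * (ε / 2) := by gcongr
      _ = ε / 2 := by rw [← add_mul, hab, one_mul]
  have := dist_triangle_left (a • x + b • y) w (a • x' + b • y')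
  have := dist_triangle (a • x + b • y) (a • x' + b • y') w
  rw [dist_comm w] at hww
  linarith

/-- Blaschke's selection theorem: the convex bodies inside a compact set form a compact set. -/
theorem isCompact_setOf_subset {s : Set V} (hs : IsCompact s) :
    IsCompact {K : ConvexBody V | (K : Set V) ⊆ s} :=
  (⟨isometry_toNonemptyCompacts.isEmbedding, isClosed_range_toNonemptyCompacts⟩ :
    IsClosedEmbedding (toNonemptyCompacts (V := V))).isCompact_preimage
    (TopologicalSpace.NonemptyCompacts.isCompact_subsets_of_isCompact hs)

@[simp]
theorem coe_translate (K : ConvexBody V) (x : V) :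
    (K.translate x : Set V) = (fun y => y + x) '' (K : Set V) := rfl

theorem translate_translate (K : ConvexBody V) (x y : V) :
    (K.translate x).translate y = K.translate (x + y) := by
  ext1
  simp only [coe_translate, image_image, add_assoc]

@[simp]
theorem translate_zero (K : ConvexBody V) : K.translate 0 = K := by
  ext1
  simp

theorem dist_translate_le (K L : ConvexBody V) (x y : V) :
    dist (K.translate x) (L.translate y) ≤ dist K L + dist x y := by
  have key : ∀ (K L : ConvexBody V) (x y : V) (ε : ℝ), 0 < ε → ∀ z ∈ K.translate x,
      ∃ w ∈ L.translate y, dist z w ≤ dist K L + dist x y + ε := by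
    rintro K L x y ε hε _ ⟨z, hz, rfl⟩
    obtain ⟨w, hw, hzw⟩ := exists_dist_lt (lt_add_of_pos_right (dist K L) hε) hz
    refine ⟨w + y, ⟨w, hw, rfl⟩, ?_⟩
    have := dist_add_add_le z x w y
    dsimp only
    linarith
  refine le_of_forall_pos_le_add fun ε hε => dist_le_of_forall_exists (by positivity)
    (key K L x y ε hε) ?_
  rw [dist_comm K, dist_comm x]
  exact key L K y x ε hε

theorem continuous_translate : Continuous fun p : ConvexBody V × V => p.1.translate p.2 := by
  refine (LipschitzWith.of_dist_le_mul (K := 2) fun p q => ?_).continuous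
  have := dist_translate_le p.1 q.1 p.2 q.2
  have h1 : dist p.1 q.1 ≤ dist p q := le_max_left _ _
  have h2 : dist p.2 q.2 ≤ dist p q := le_max_right _ _
  simp only [NNReal.coe_ofNat]
  linarith

/-- The intersection of a convex body with a closed ball around the origin that it meets. -/
def truncate (K : ConvexBody V) (r : ℝ) (h : ((K : Set V) ∩ closedBall 0 r).Nonempty) :
    ConvexBody V where
  carrier := (K : Set V) ∩ closedBall 0 r
  convex' := K.convex.inter (convex_closedBall _ _)
  isCompact' := K.isCompact.inter_right isClosed_closedBall
  nonempty' := h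

theorem coe_truncate (K : ConvexBody V) (r : ℝ) (h : ((K : Set V) ∩ closedBall 0 r).Nonempty) :
    (K.truncate r h : Set V) = (K : Set V) ∩ closedBall 0 r := rfl

/-- Approximating `z` directly by a point of `L` could leave the ball of radius `r'`. So `z` is
first moved towards `p`, which has depth `s`, by the fraction `2 * δ / s`. This gains `2 * δ` in
norm: one `δ` for the approximation, one for the change of radius. -/
theorem exists_mem_norm_le_of_forall_exists_dist_le {K L : ConvexBody V} {r r' δ s : ℝ} {p z : V}
    (hp : p ∈ K) (hps : ‖p‖ ≤ r - s) (hs : 0 < s) (hδ : 2 * δ ≤ s) (hr : |r - r'| ≤ δ)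
    (hKL : ∀ x ∈ K, ∃ y ∈ L, dist x y ≤ δ) (hz : z ∈ K) (hzr : ‖z‖ ≤ r) :
    ∃ w ∈ L, ‖w‖ ≤ r' ∧ dist z w ≤ δ + 2 * r * (2 * δ / s) := by
  have hδ0 : 0 ≤ δ := (abs_nonneg _).trans hr
  set t := 2 * δ / s with ht
  have ht0 : 0 ≤ t := by positivity
  have ht1 : t ≤ 1 := (div_le_one hs).2 hδ
  have hts : t * s = 2 * δ := div_mul_cancel₀ _ hs.ne'
  obtain ⟨w, hw, hzw⟩ := hKL _ (K.convex hz hp (sub_nonneg.2 ht1) ht0 (by ring))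
  have hnorm : ‖(1 - t) • z + t • p‖ ≤ r - 2 * δ := by
    calc _ ≤ ‖(1 - t) • z‖ + ‖t • p‖ := norm_add_le _ _
      _ = (1 - t) * ‖z‖ + t * ‖p‖ := by
        rw [norm_smul, norm_smul, Real.norm_of_nonneg ht0, Real.norm_of_nonneg (sub_nonneg.2 ht1)]
      _ ≤ (1 - t) * r + t * (r - s) := by
        have := sub_nonneg.2 ht1
        gcongr
      _ = r - 2 * δ := by rw [← hts]; ring
  refine ⟨w, hw, ?_, ?_⟩
  · have h1 : ‖w‖ ≤ ‖(1 - t) • z + t • p‖ + δ := by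
      rw [dist_comm] at hzw
      have := norm_le_norm_add_norm_sub' w ((1 - t) • z + t • p)
      rw [← dist_eq_norm] at this
      linarith
    have := (abs_le.1 hr).2
    linarith
  · have h1 : dist z ((1 - t) • z + t • p) ≤ 2 * r * t := by
      rw [dist_eq_norm, show z - ((1 - t) • z + t • p) = t • (z - p) by module, norm_smul,
        Real.norm_of_nonneg ht0, mul_comm]
      have := norm_sub_le z p
      gcongr
      linarith
    linarith [dist_triangle z ((1 - t) • z + t • p) w]

theorem dist_truncate_le {K L : ConvexBody V} {r r' δ s : ℝ} {p q : V}
    (hp : p ∈ K) (hps : ‖p‖ ≤ r - s) (hq : q ∈ L) (hqs : ‖q‖ ≤ r' - s) (hs : 0 < s)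
    (hδ : 2 * δ ≤ s) (hr : |r - r'| ≤ δ) (hKL : dist K L < δ)
    (hK : ((K : Set V) ∩ closedBall 0 r).Nonempty)
    (hL : ((L : Set V) ∩ closedBall 0 r').Nonempty) :
    dist (K.truncate r hK) (L.truncate r' hL) ≤ δ + 2 * max r r' * (2 * δ / s) := by
  have hδ0 : 0 ≤ δ := (abs_nonneg _).trans hr
  have hr0 : 0 ≤ max r r' := le_max_of_le_left (by linarith [norm_nonneg p])
  refine dist_le_of_forall_exists (by positivity) ?_ ?_
  · rintro z ⟨hz, hzr⟩
    obtain ⟨w, hw, hwr, hd⟩ := exists_mem_norm_le_of_forall_exists_dist_le hp hps hs hδ hr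
      (fun x hx => (exists_dist_lt hKL hx).imp fun y hy => ⟨hy.1, hy.2.le⟩) hz (by simpa using hzr)
    refine ⟨w, ⟨hw, by simpa using hwr⟩, hd.trans ?_⟩
    gcongr
    exact le_max_left _ _
  · rintro z ⟨hz, hzr⟩
    rw [dist_comm] at hKL
    rw [abs_sub_comm] at hr
    obtain ⟨w, hw, hwr, hd⟩ := exists_mem_norm_le_of_forall_exists_dist_le hq hqs hs hδ hr
      (fun x hx => (exists_dist_lt hKL hx).imp fun y hy => ⟨hy.1, hy.2.le⟩) hz (by simpa using hzr)
    refine ⟨w, ⟨hw, by simpa using hwr⟩, hd.trans ?_⟩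
    gcongr
    exact le_max_right _ _

end ConvexBody

/-! ### Cutting a valuation off to bounded support. -/

open ConvexBody

section

variable {V : Type*} [NormedAddCommGroup V] [NormedSpace ℝ V]

open Classical in
/-- The value of `φ` at `K ∩ closedBall 0 r`, with the convention `φ ∅ = 0`. -/
noncomputable def truncatedValue (φ : ConvexBody V → ℂ) (K : ConvexBody V) (r : ℝ) : ℂ :=
  if h : ((K : Set V) ∩ closedBall 0 r).Nonempty then φ (K.truncate r h) else 0

theorem truncatedValue_of_nonempty (φ : ConvexBody V → ℂ) {K : ConvexBody V} {r : ℝ}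
    (h : ((K : Set V) ∩ closedBall 0 r).Nonempty) :
    truncatedValue φ K r = φ (K.truncate r h) := dif_pos h

theorem truncatedValue_of_not_nonempty (φ : ConvexBody V → ℂ) {K : ConvexBody V} {r : ℝ}
    (h : ¬((K : Set V) ∩ closedBall 0 r).Nonempty) : truncatedValue φ K r = 0 := dif_neg h

theorem truncatedValue_of_subset (φ : ConvexBody V → ℂ) {K : ConvexBody V} {r : ℝ}
    (h : (K : Set V) ⊆ closedBall 0 r) : truncatedValue φ K r = φ K := by
  have h' : (K : Set V) ∩ closedBall 0 r = K := inter_eq_left.2 h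
  rw [truncatedValue_of_nonempty φ (by rw [h']; exact K.nonempty)]
  congr 1
  exact ConvexBody.ext h'

/-- If `K` and `L` both meet the ball, their traces have convex, hence connected, union and so
intersect. In the other cases the convention `φ ∅ = 0` gives the identity. -/
theorem IsValuation.truncatedValue {φ : ConvexBody V → ℂ} (hφ : IsValuation φ) (r : ℝ) :
    IsValuation fun K => truncatedValue φ K r := by
  intro K L h
  set B : Set V := closedBall 0 r
  have hU : (K.union L h : Set V) ∩ B = ((K : Set V) ∩ B) ∪ ((L : Set V) ∩ B) :=
    union_inter_distrib_right _ _ _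
  have hI : (K.inter L h : Set V) ∩ B = ((K : Set V) ∩ B) ∩ ((L : Set V) ∩ B) :=
    inter_inter_distrib_right _ _ _
  by_cases hK : ((K : Set V) ∩ B).Nonempty <;> by_cases hL : ((L : Set V) ∩ B).Nonempty
  · have hc : Convex ℝ ((K.truncate r hK : Set V) ∪ (L.truncate r hL)) := by
      rw [coe_truncate, coe_truncate, ← hU]
      exact (K.union L h).convex.inter (convex_closedBall _ _)
    have hU' : ((K.union L h : Set V) ∩ B).Nonempty := hU ▸ hK.mono subset_union_left
    have hI' : ((K.inter L h : Set V) ∩ B).Nonempty :=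
      hI ▸ inter_nonempty_of_convex_union _ _ hc
    simp only [truncatedValue_of_nonempty φ hK, truncatedValue_of_nonempty φ hL,
      truncatedValue_of_nonempty φ hU', truncatedValue_of_nonempty φ hI']
    have e1 : (K.union L h).truncate r hU' = (K.truncate r hK).union (L.truncate r hL) hc :=
      ConvexBody.ext hU
    have e2 : (K.inter L h).truncate r hI' = (K.truncate r hK).inter (L.truncate r hL) hc :=
      ConvexBody.ext hI
    rw [e1, e2, hφ]
  · have hL' := not_nonempty_iff_eq_empty.1 hL
    rw [hL', union_empty] at hU
    rw [hL', inter_empty] at hI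
    have hU' : ((K.union L h : Set V) ∩ B).Nonempty := hU ▸ hK
    simp only [truncatedValue_of_nonempty φ hK, truncatedValue_of_not_nonempty φ hL,
      truncatedValue_of_nonempty φ hU',
      truncatedValue_of_not_nonempty φ (not_nonempty_iff_eq_empty.2 hI)]
    have e1 : (K.union L h).truncate r hU' = K.truncate r hK := ConvexBody.ext hU
    rw [e1]
    ring
  · have hK' := not_nonempty_iff_eq_empty.1 hK
    rw [hK', empty_union] at hU
    rw [hK', empty_inter] at hI
    have hU' : ((K.union L h : Set V) ∩ B).Nonempty := hU ▸ hL
    simp only [truncatedValue_of_nonempty φ hL, truncatedValue_of_not_nonempty φ hK,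
      truncatedValue_of_nonempty φ hU',
      truncatedValue_of_not_nonempty φ (not_nonempty_iff_eq_empty.2 hI)]
    have e1 : (K.union L h).truncate r hU' = L.truncate r hL := ConvexBody.ext hU
    rw [e1]
    ring
  · have hK' := not_nonempty_iff_eq_empty.1 hK
    have hL' := not_nonempty_iff_eq_empty.1 hL
    rw [hK', hL', union_empty] at hU
    rw [hK', empty_inter] at hI
    simp only [truncatedValue_of_not_nonempty φ hL, truncatedValue_of_not_nonempty φ hK,
      truncatedValue_of_not_nonempty φ (not_nonempty_iff_eq_empty.2 hU),
      truncatedValue_of_not_nonempty φ (not_nonempty_iff_eq_empty.2 hI)]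
    ring

/-- Below the critical radius nearby truncations are empty. Above it, some point of `K₀` is interior
to the ball, and `dist_truncate_le` applies. -/
theorem continuousAt_truncatedValue {φ : ConvexBody V → ℂ} (hφ : Continuous φ)
    {K₀ : ConvexBody V} {r₀ : ℝ} (h : r₀ ≠ infDist 0 (K₀ : Set V)) :
    ContinuousAt (fun p : ConvexBody V × ℝ => truncatedValue φ p.1 p.2) (K₀, r₀) := by
  rcases lt_or_gt_of_ne h with h | h
  · have hev : ∀ᶠ p in 𝓝 (K₀, r₀), truncatedValue φ p.1 p.2 = 0 := by
      refine Metric.eventually_nhds_iff.2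
        ⟨(infDist 0 (K₀ : Set V) - r₀) / 2, by linarith, ?_⟩
      rintro ⟨K, r⟩ hd
      rw [Prod.dist_eq, max_lt_iff] at hd
      refine truncatedValue_of_not_nonempty φ ?_
      rintro ⟨w, hw, hwr⟩
      obtain ⟨z, hz, hwz⟩ := exists_dist_lt hd.1 hw
      have h1 : infDist 0 (K₀ : Set V) ≤ dist 0 z := infDist_le_dist_of_mem hz
      have h2 := dist_triangle 0 w z
      have h3 : dist 0 w ≤ r := by simpa [dist_comm] using hwr
      have h4 := (abs_lt.1 hd.2).2
      dsimp only at h4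
      linarith
    exact continuousAt_const.congr (hev.mono fun _ h => h.symm)
  · obtain ⟨p, hp, hpr⟩ := (infDist_lt_iff K₀.nonempty).1 h
    rw [dist_zero_left] at hpr
    have hne : ((K₀ : Set V) ∩ closedBall 0 r₀).Nonempty := ⟨p, hp, by simpa using hpr.le⟩
    rw [Metric.continuousAt_iff]
    intro ε hε
    obtain ⟨η, hη, H⟩ := Metric.continuous_iff.1 hφ (K₀.truncate r₀ hne) ε hε
    set g := r₀ - ‖p‖ with hg
    have hg0 : 0 < g := sub_pos.2 hpr
    have hr₀ : 0 < r₀ := (norm_nonneg p).trans_lt hpr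
    -- `C` is the factor of `δ` in `dist_truncate_le` with depth `s = g / 2` and radii at most `r₀ +
    -- g`. The bound `δ ≤ g / 4` leaves both `p` and its approximant `q` at that depth.
    set C := 1 + 2 * (r₀ + g) * (2 / (g / 2)) with hC
    have hC0 : 0 < C := by positivity
    set δ := min (g / 4) (η / (2 * C)) with hδ
    have hδ0 : 0 < δ := by positivity
    have hδg : δ ≤ g / 4 := min_le_left _ _
    have hδη : δ ≤ η / (2 * C) := min_le_right _ _
    refine ⟨δ, hδ0, ?_⟩
    rintro ⟨K, r⟩ hd
    rw [Prod.dist_eq, max_lt_iff] at hd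
    obtain ⟨hd1, hd2⟩ := hd
    dsimp only at hd1 hd2 ⊢
    have hdr : |r - r₀| ≤ δ := hd2.le
    obtain ⟨hd3, hd4⟩ := abs_le.1 hdr
    obtain ⟨q, hq, hpq⟩ := exists_dist_lt (dist_comm K K₀ ▸ hd1) hp
    have hqr : ‖q‖ ≤ r - g / 2 := by
      have := norm_le_norm_add_norm_sub' q p
      rw [← dist_eq_norm, dist_comm] at this
      linarith
    have hneK : ((K : Set V) ∩ closedBall 0 r).Nonempty :=
      ⟨q, hq, by simpa using hqr.trans (by linarith)⟩
    rw [truncatedValue_of_nonempty φ hneK, truncatedValue_of_nonempty φ hne]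
    refine H _ ?_
    have hb := dist_truncate_le hq hqr hp (show ‖p‖ ≤ r₀ - g / 2 by linarith) (half_pos hg0)
      (by linarith) hdr hd1 hneK hne
    have hmax : max r r₀ ≤ r₀ + g := max_le (by linarith) (by linarith)
    calc _ ≤ δ + 2 * max r r₀ * (2 * δ / (g / 2)) := hb
      _ ≤ δ + 2 * (r₀ + g) * (2 * δ / (g / 2)) := by gcongr
      _ = δ * C := by rw [hC]; ring
      _ ≤ η / (2 * C) * C := by gcongr
      _ = η / 2 := by field_simp
      _ < η := half_lt_self hη

theorem exists_norm_le_of_subset {s : Set V} (hs : IsCompact s) {φ : ConvexBody V → ℂ}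
    (hφ : Continuous φ) : ∃ M : ℝ, 0 ≤ M ∧ ∀ K : ConvexBody V, (K : Set V) ⊆ s → ‖φ K‖ ≤ M := by
  obtain ⟨M, hM⟩ := (isCompact_setOf_subset hs).exists_bound_of_continuousOn hφ.continuousOn
  exact ⟨max M 0, le_max_right _ _, fun K hK => (hM K hK).trans (le_max_left _ _)⟩

/-- The bound is uniform in `K` because all truncations lie in one ball, whose convex subbodies form
a compact set. It dominates the integrand of `cutoff`. -/
theorem exists_norm_truncatedValue_le [FiniteDimensional ℝ V] {φ : ConvexBody V → ℂ}
    (hφ : Continuous φ) (R : ℝ) :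
    ∃ M : ℝ, 0 ≤ M ∧ ∀ (K : ConvexBody V) (r : ℝ), r ≤ R → ‖truncatedValue φ K r‖ ≤ M := by
  have := FiniteDimensional.proper ℝ V
  obtain ⟨M, hM0, hM⟩ := exists_norm_le_of_subset (isCompact_closedBall (0 : V) R) hφ
  refine ⟨M, hM0, fun K r hr => ?_⟩
  by_cases h : ((K : Set V) ∩ closedBall 0 r).Nonempty
  · rw [truncatedValue_of_nonempty φ h]
    exact hM _ (inter_subset_right.trans (closedBall_subset_closedBall hr))
  · rwa [truncatedValue_of_not_nonempty φ h, norm_zero]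

theorem aestronglyMeasurable_truncatedValue {φ : ConvexBody V → ℂ} (hφ : Continuous φ)
    (K : ConvexBody V) (μ : Measure ℝ) [NullSingletonClass μ] :
    AEStronglyMeasurable (truncatedValue φ K) μ := by
  have hc : ContinuousOn (truncatedValue φ K) {infDist 0 (K : Set V)}ᶜ := fun r hr =>
    ((continuousAt_truncatedValue hφ hr).comp
      (f := fun r : ℝ => (K, r)) (by fun_prop)).continuousWithinAt
  have := hc.aestronglyMeasurable (μ := μ) (measurableSet_singleton _).compl
  rwa [Measure.restrict_eq_self_of_ae_mem] at this
  exact compl_mem_ae_iff.2 (measure_singleton _)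

theorem integrable_truncatedValue [FiniteDimensional ℝ V] {φ : ConvexBody V → ℂ}
    (hφ : Continuous φ) (K : ConvexBody V) (a : ℝ) :
    IntegrableOn (truncatedValue φ K) (Icc a (a + 1)) := by
  obtain ⟨M, -, hM⟩ := exists_norm_truncatedValue_le hφ (a + 1)
  exact IntegrableOn.of_bound measure_Icc_lt_top (aestronglyMeasurable_truncatedValue hφ K _) M
    ((ae_restrict_mem measurableSet_Icc).mono fun r hr => hM K r hr.2)

/-- The truncations of a continuous valuation to the balls of radius `r`, averaged over
`r ∈ [a, a + 1]`. -/
noncomputable def cutoff [FiniteDimensional ℝ V] (φ : CVal V) (a : ℝ) : CVal V where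
  val :=
    { toFun := fun K => ∫ r in Icc a (a + 1), truncatedValue φ.1 K r
      continuous_toFun := by
        obtain ⟨M, -, hM⟩ := exists_norm_truncatedValue_le φ.1.continuous (a + 1)
        refine continuous_iff_continuousAt.2 fun K₀ => ?_
        refine continuousAt_of_dominated (bound := fun _ => M)
          (.of_forall fun K => aestronglyMeasurable_truncatedValue φ.1.continuous K _)
          (.of_forall fun K => (ae_restrict_mem measurableSet_Icc).mono fun r hr => hM K r hr.2)
          (integrableOn_const measure_Icc_lt_top.ne) ?_
        -- The only radius at which continuity can fail at `K₀` is a null set.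
        have hne : ∀ᵐ r : ℝ ∂volume.restrict (Icc a (a + 1)), r ≠ infDist 0 (K₀ : Set V) :=
          compl_mem_ae_iff.2 (measure_singleton _)
        filter_upwards [hne] with r hr
        exact (continuousAt_truncatedValue φ.1.continuous hr).comp
          (f := fun K : ConvexBody V => (K, r)) (by fun_prop) }
  property := by
    intro K L h
    have hi := fun K => integrable_truncatedValue φ.1.continuous K a
    simp only [ContinuousMap.coe_mk]
    rw [← integral_add' (hi K) (hi L), ← integral_sub' ((hi K).add (hi L)) (hi _)]
    exact integral_congr_ae (.of_forall fun r => φ.2.truncatedValue r K L h)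

theorem cutoff_apply [FiniteDimensional ℝ V] (φ : CVal V) (a : ℝ) (K : ConvexBody V) :
    (cutoff φ a).1 K = ∫ r in Icc a (a + 1), truncatedValue φ.1 K r := rfl

theorem cutoff_of_subset [FiniteDimensional ℝ V] (φ : CVal V) {a : ℝ} {K : ConvexBody V}
    (h : (K : Set V) ⊆ closedBall 0 a) : (cutoff φ a).1 K = φ.1 K := by
  have : ∀ r ∈ Icc a (a + 1), truncatedValue φ.1 K r = φ.1 K := fun r hr =>
    truncatedValue_of_subset _ (h.trans (closedBall_subset_closedBall hr.1))
  rw [cutoff_apply, setIntegral_congr_fun measurableSet_Icc this]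
  simp

theorem cutoff_of_disjoint [FiniteDimensional ℝ V] (φ : CVal V) {a : ℝ} {K : ConvexBody V}
    (h : Disjoint (K : Set V) (closedBall 0 (a + 1))) : (cutoff φ a).1 K = 0 := by
  rw [cutoff_apply]
  refine setIntegral_eq_zero_of_forall_eq_zero fun r hr => truncatedValue_of_not_nonempty _ ?_
  rw [not_nonempty_iff_eq_empty, ← disjoint_iff_inter_eq_empty]
  exact h.mono_right (closedBall_subset_closedBall hr.2)

/-- A function on convex bodies is supported in the closed ball of radius `R` if it vanishes
on the bodies disjoint from that ball. -/
def SupportedInBall (φ : ConvexBody V → ℂ) (R : ℝ) : Prop :=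
  ∀ K : ConvexBody V, Disjoint (K : Set V) (closedBall 0 R) → φ K = 0

theorem SupportedInBall.translate_eq_zero {φ : ConvexBody V → ℂ} {R R₀ : ℝ}
    (hφ : SupportedInBall φ R) {K : ConvexBody V} (hK : (K : Set V) ⊆ closedBall 0 R₀) {x : V}
    (hx : x ∉ closedBall (0 : V) (R₀ + R)) : φ (K.translate (-x)) = 0 := by
  refine hφ _ (disjoint_left.2 ?_)
  rintro _ ⟨z, hz, rfl⟩ hzx
  have h1 := hK hz
  simp only [mem_closedBall, dist_zero_right, not_le] at h1 hzx hx
  have h2 := norm_le_norm_add_norm_sub z x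
  rw [← sub_eq_add_neg] at hzx
  linarith

theorem IsValuation.translate {φ : ConvexBody V → ℂ} (hφ : IsValuation φ) (x : V) :
    IsValuation fun K => φ (K.translate x) := by
  intro K L h
  have hU : (fun y => y + x) '' ((K : Set V) ∪ L) = (K.translate x : Set V) ∪ L.translate x :=
    image_union _ _ _
  have hc : Convex ℝ ((K.translate x : Set V) ∪ L.translate x) :=
    hU ▸ ((K.union L h).translate x).convex
  have e1 : (K.union L h).translate x = (K.translate x).union (L.translate x) hc :=
    ConvexBody.ext hU
  have e2 : (K.inter L h).translate x = (K.translate x).inter (L.translate x) hc :=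
    ConvexBody.ext (image_inter (add_left_injective x))
  dsimp only
  rw [e1, e2, hφ]

theorem continuous_translate_neg {φ : ConvexBody V → ℂ} (hφ : Continuous φ) (K : ConvexBody V) :
    Continuous fun x : V => φ (K.translate (-x)) :=
  hφ.comp (continuous_translate.comp (by fun_prop : Continuous fun x : V => (K, -x)))

theorem subset_closedBall_of_dist_lt {K L : ConvexBody V} {R δ : ℝ}
    (hK : (K : Set V) ⊆ closedBall 0 R) (h : dist L K < δ) :
    (L : Set V) ⊆ closedBall 0 (R + δ) := by
  intro x hx
  obtain ⟨y, hy, hxy⟩ := exists_dist_lt h hx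
  have h1 := hK hy
  rw [mem_closedBall] at h1 ⊢
  linarith [dist_triangle x y 0]

/-! ### Convolution of a boundedly supported valuation with a weight. -/

section Convolution

variable [FiniteDimensional ℝ V]

theorem hasCompactSupport_translate_neg {φ : ConvexBody V → ℂ} {R : ℝ}
    (hs : SupportedInBall φ R) (K : ConvexBody V) :
    HasCompactSupport fun x : V => φ (K.translate (-x)) := by
  have := FiniteDimensional.proper ℝ V
  obtain ⟨R₀, hR₀⟩ := K.isBounded.subset_closedBall 0
  exact HasCompactSupport.intro (isCompact_closedBall 0 (R₀ + R)) fun x hx =>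
    hs.translate_eq_zero hR₀ hx

/-- A complex-valued polynomial in real linear functionals, as a continuous function. -/
noncomputable def polynomialFunction (p : MvPolynomial (Module.Dual ℝ V) ℂ) : C(V, ℂ) :=
  MvPolynomial.aeval (fun l : Module.Dual ℝ V =>
    (⟨fun x => ((l x : ℝ) : ℂ),
      Complex.continuous_ofReal.comp l.continuous_of_finiteDimensional⟩ : C(V, ℂ))) p

/-- Taylor expansion: `p (x + y)` is a polynomial in `y` with coefficients continuous in `x`. -/
theorem exists_polynomialFunction_add_eq (p : MvPolynomial (Module.Dual ℝ V) ℂ) :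
    ∃ q : MvPolynomial (Module.Dual ℝ V) C(V, ℂ), ∀ x y : V, polynomialFunction p (x + y) =
      ∑ m ∈ q.support, q.coeff m x * m.prod fun l n => ((l y : ℝ) : ℂ) ^ n := by
  -- The sum is `eval₂` unfolded. In this form the induction only uses ring identities and `l (x +
  -- y) = l x + l y`.
  suffices h : ∃ q : MvPolynomial (Module.Dual ℝ V) C(V, ℂ), ∀ x y : V,
      polynomialFunction p (x + y) =
        q.eval₂ (ContinuousMap.evalAlgHom ℂ ℂ x : C(V, ℂ) →ₐ[ℂ] ℂ).toRingHom
          (fun l => ((l y : ℝ) : ℂ)) from h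
  induction p using MvPolynomial.induction_on with
  | C a => exact ⟨MvPolynomial.C (ContinuousMap.const V a), by simp [polynomialFunction]⟩
  | add p q hp hq =>
    obtain ⟨P, hP⟩ := hp
    obtain ⟨Q, hQ⟩ := hq
    refine ⟨P + Q, fun x y => ?_⟩
    rw [MvPolynomial.eval₂_add, ← hP, ← hQ]
    simp [polynomialFunction]
  | mul_X p l hp =>
    obtain ⟨P, hP⟩ := hp
    refine ⟨P * (MvPolynomial.X l + MvPolynomial.C ⟨fun x => ((l x : ℝ) : ℂ),
      Complex.continuous_ofReal.comp l.continuous_of_finiteDimensional⟩), fun x y => ?_⟩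
    rw [MvPolynomial.eval₂_mul, ← hP]
    simp [polynomialFunction, add_comm]

variable [MeasurableSpace V] [BorelSpace V]

theorem integrable_mul_translate {φ : ConvexBody V → ℂ} (hφ : Continuous φ) {R : ℝ}
    (hs : SupportedInBall φ R) (f : C(V, ℂ)) (μ : Measure V) [IsFiniteMeasureOnCompacts μ]
    (K : ConvexBody V) : Integrable (fun x => f x * φ (K.translate (-x))) μ :=
  (f.continuous.mul (continuous_translate_neg hφ K)).integrable_of_hasCompactSupport
    (hasCompactSupport_translate_neg hs K).mul_left

/-- The average of the translates of a continuous valuation with bounded support, with weight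
`f`. -/
noncomputable def weightedTranslates (φ : CVal V) {R : ℝ} (hs : SupportedInBall φ.1 R)
    (f : C(V, ℂ)) (μ : Measure V) [IsFiniteMeasureOnCompacts μ] : CVal V where
  val :=
    { toFun := fun K => ∫ x, f x * φ.1 (K.translate (-x)) ∂μ
      continuous_toFun := by
        have := FiniteDimensional.proper ℝ V
        refine continuous_iff_continuousAt.2 fun K₀ => ?_
        obtain ⟨R₀, hR₀⟩ := K₀.isBounded.subset_closedBall 0
        -- For bodies within distance `1` of `K₀` the integrands vanish outside a common compact
        -- ball.
        refine ContinuousOn.continuousAt (s := ball K₀ 1) ?_ (ball_mem_nhds _ one_pos)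
        refine continuousOn_integral_of_compact_support
          (f := fun (K : ConvexBody V) (x : V) => f x * φ.1 (K.translate (-x)))
          (isCompact_closedBall 0 (R₀ + 1 + R)) ?_ ?_
        · refine Continuous.continuousOn (Continuous.mul (by fun_prop) ?_)
          exact φ.1.continuous.comp (continuous_translate.comp
            (by fun_prop : Continuous fun p : ConvexBody V × V => (p.1, -p.2)))
        · intro K x hK hx
          rw [hs.translate_eq_zero (subset_closedBall_of_dist_lt hR₀ hK) hx, mul_zero] }
  property := by
    intro K L h
    have hi := integrable_mul_translate φ.1.continuous hs f μ
    simp only [ContinuousMap.coe_mk]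
    rw [← integral_add' (hi K) (hi L), ← integral_sub' ((hi K).add (hi L)) (hi _)]
    refine integral_congr_ae (.of_forall fun x => ?_)
    have := φ.2.translate (-x) K L h
    dsimp only at this ⊢
    rw [this, Pi.sub_apply, Pi.add_apply]
    ring

theorem weightedTranslates_apply (φ : CVal V) {R : ℝ} (hs : SupportedInBall φ.1 R)
    (f : C(V, ℂ)) (μ : Measure V) [IsFiniteMeasureOnCompacts μ] (K : ConvexBody V) :
    (weightedTranslates φ hs f μ).1 K = ∫ x, f x * φ.1 (K.translate (-x)) ∂μ := rfl

theorem weightedTranslates_translate (φ : CVal V) {R : ℝ} (hs : SupportedInBall φ.1 R)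
    (f : C(V, ℂ)) (μ : Measure V) [μ.IsAddHaarMeasure] (K : ConvexBody V) (y : V) :
    (weightedTranslates φ hs f μ).1 (K.translate y) =
      ∫ x, f (x + y) * φ.1 (K.translate (-x)) ∂μ := by
  rw [weightedTranslates_apply,
    ← integral_add_right_eq_self (fun x => f x * φ.1 ((K.translate y).translate (-x))) y]
  simp [ConvexBody.translate_translate]

/-- Integrating the Taylor expansion of `p (x + y)` termwise gives a polynomial in `y`. The body
enters only through the coefficients, so the degree bound is the same for all `K`. -/
theorem weightedTranslates_mem_PVal (φ : CVal V) {R : ℝ} (hs : SupportedInBall φ.1 R)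
    (p : MvPolynomial (Module.Dual ℝ V) ℂ) (μ : Measure V) [μ.IsAddHaarMeasure] :
    weightedTranslates φ hs (polynomialFunction p) μ ∈ PVal V := by
  obtain ⟨q, hq⟩ := exists_polynomialFunction_add_eq p
  refine ⟨q.totalDegree, (weightedTranslates φ hs (polynomialFunction p) μ).2, fun K => ?_⟩
  refine ⟨∑ m ∈ q.support, MvPolynomial.monomial m
    (∫ x, q.coeff m x * φ.1 (K.translate (-x)) ∂μ), ?_, fun y => ?_⟩
  · refine MvPolynomial.totalDegree_finsetSum_le fun m hm => ?_
    exact (MvPolynomial.totalDegree_monomial_le _ _).trans (MvPolynomial.le_totalDegree hm)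
  · dsimp only
    rw [weightedTranslates_translate, map_sum]
    simp only [hq, Finset.sum_mul, MvPolynomial.eval_monomial]
    rw [integral_finsetSum]
    · refine Finset.sum_congr rfl fun m _ => ?_
      rw [← integral_mul_const]
      congr 1 with x
      ring
    · intro m _
      convert! (integrable_mul_translate φ.1.continuous hs (q.coeff m) μ K).mul_const
        (m.prod fun l n => ((l y : ℝ) : ℂ) ^ n) using 2
      ring

end Convolution

/-! ### Polynomial approximation and density. -/

theorem exists_polynomialFunction_near [FiniteDimensional ℝ V] (g : C(V, ℝ)) {s : Set V}
    (hs : IsCompact s) {ε : ℝ} (hε : 0 < ε) :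
    ∃ p : MvPolynomial (Module.Dual ℝ V) ℂ, ∀ x ∈ s, ‖polynomialFunction p x - g x‖ < ε := by
  let F : MvPolynomial (Module.Dual ℝ V) ℝ →ₐ[ℝ] C(V, ℝ) :=
    MvPolynomial.aeval fun l => ⟨l, l.continuous_of_finiteDimensional⟩
  have hsep : F.range.SeparatesPoints := by
    intro x y hxy
    obtain ⟨l, hl⟩ := SeparatingDual.exists_separating_of_ne (R := ℝ) hxy
    exact ⟨l, ⟨F (MvPolynomial.X l.toLinearMap), ⟨_, rfl⟩, by simp [F]⟩, hl⟩
  obtain ⟨_, ⟨p, rfl⟩, hp⟩ :=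
    ContinuousMap.exists_mem_subalgebra_near_continuous_of_isCompact_of_separatesPoints hsep g hs hε
  refine ⟨p.map Complex.ofRealHom, fun x hx => ?_⟩
  have hF : polynomialFunction (p.map Complex.ofRealHom) x = (F p x : ℝ) := by
    clear hp
    induction p using MvPolynomial.induction_on with
    | C a => simp [polynomialFunction, F]
    | add p q hp hq => simp_all [polynomialFunction]
    | mul_X p l hp => simp_all [polynomialFunction, F]
  have := hp x hx
  rw [hF, ← Complex.ofReal_sub, Complex.norm_real]
  exact this

theorem exists_subset_closedBall_of_isCompact {S : Set (ConvexBody V)} (hS : IsCompact S) :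
    ∃ R : ℝ, 0 ≤ R ∧ ∀ K ∈ S, (K : Set V) ⊆ closedBall 0 R := by
  obtain ⟨D, hD⟩ := hS.isBounded.subset_ball (0 : ConvexBody V)
  refine ⟨max D 0, le_max_right _ _, fun K hK => ?_⟩
  have h0 : ((0 : ConvexBody V) : Set V) ⊆ closedBall 0 0 := by simp
  have := subset_closedBall_of_dist_lt h0 (hD hK)
  rw [zero_add] at this
  exact this.trans (closedBall_subset_closedBall (le_max_left _ _))

/-- Joint continuity in `(x, K)` and compactness of `S` (tube lemma) make `δ` uniform over `S`. -/
theorem exists_forall_norm_translate_sub_lt {φ : ConvexBody V → ℂ} (hφ : Continuous φ)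
    {S : Set (ConvexBody V)} (hS : IsCompact S) {ε : ℝ} (hε : 0 < ε) :
    ∃ δ > 0, ∀ x : V, ‖x‖ < δ → ∀ K ∈ S, ‖φ (K.translate (-x)) - φ K‖ < ε := by
  have hc : Continuous fun p : V × ConvexBody V => ‖φ (p.2.translate (-p.1)) - φ p.2‖ :=
    ((hφ.comp (continuous_translate.comp
      (by fun_prop : Continuous fun p : V × ConvexBody V => (p.2, -p.1)))).sub
      (hφ.comp continuous_snd)).norm
  have := hS.eventually_forall_of_forall_eventually (x₀ := (0 : V))
    (P := fun x K => ‖φ (K.translate (-x)) - φ K‖ < ε) fun K _ =>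
      hc.continuousAt.eventually_lt continuousAt_const (by simpa using hε)
  obtain ⟨δ, hδ, H⟩ := Metric.eventually_nhds_iff.1 this
  exact ⟨δ, hδ, fun x hx => H (by simpa using hx)⟩

theorem CVal.mem_closure_iff {s : Set (CVal V)} {φ : CVal V} :
    φ ∈ closure s ↔ ∀ S : Set (ConvexBody V), IsCompact S → ∀ ε > 0,
      ∃ ψ ∈ s, ∀ K ∈ S, ‖ψ.1 K - φ.1 K‖ < ε := by
  have hb := (nhds_basis_uniformity (Metric.uniformity_basis_dist
    (α := ℂ)).compactConvergenceUniformity (x := φ.1)).comap (Subtype.val : CVal V → _)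
  rw [← nhds_subtype_eq_comap (h := φ.2)] at hb
  rw [mem_closure_iff_nhds_basis hb]
  simp only [← dist_eq_norm]
  exact ⟨fun h S hS ε hε => h (S, ε) ⟨hS, hε⟩, fun h i hi => h i.1 hi.1 i.2 hi.2⟩

theorem exists_mem_PVal_near [FiniteDimensional ℝ V] (φ : CVal V) {S : Set (ConvexBody V)}
    (hS : IsCompact S) {ε : ℝ} (hε : 0 < ε) :
    ∃ ψ ∈ PVal V, ∀ K ∈ S, ‖ψ.1 K - φ.1 K‖ < ε := by
  have := FiniteDimensional.proper ℝ V
  borelize V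
  let μ : Measure V := Measure.addHaar
  obtain ⟨R, hR0, hR⟩ := exists_subset_closedBall_of_isCompact hS
  obtain ⟨δ, hδ, hφδ⟩ := exists_forall_norm_translate_sub_lt φ.1.continuous hS
    (show 0 < ε / 4 by positivity)
  -- The extra `1` leaves room for translations: for `K ∈ S` and `‖x‖ < 1`, `Φ` and `φ` agree on `K
  -- - x`.
  set Φ := cutoff φ (R + 1)
  have hs : SupportedInBall Φ.1 (R + 1 + 1) := fun K hK => cutoff_of_disjoint φ hK
  -- For `K ∈ S`, `Φ (K - x)` vanishes when `x ∉ B`; for `x ∈ B`, `K - x` lies in the ball used for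
  -- `M`.
  set B : Set V := closedBall 0 (R + (R + 1 + 1)) with hB
  have hBc : IsCompact B := isCompact_closedBall _ _
  obtain ⟨M, hM0, hM⟩ := exists_norm_le_of_subset
    (isCompact_closedBall (0 : V) (R + (R + (R + 1 + 1)))) Φ.1.continuous
  have hδ1 : 0 < min δ 1 := lt_min hδ one_pos
  -- Radius below `δ` makes translation nearly harmless for `φ`; radius below `1` stays where `Φ`
  -- equals `φ`.
  let b : ContDiffBump (0 : V) := ⟨min δ 1 / 2, min δ 1, half_pos hδ1, half_lt_self hδ1⟩
  let g : C(V, ℝ) := ⟨b.normed μ, b.continuous_normed⟩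
  let gC : C(V, ℂ) := ⟨fun x => (g x : ℂ), by fun_prop⟩
  have hg0 : ∀ x, 0 ≤ g x := fun x => b.nonneg_normed x
  have hgi : Integrable g μ := b.integrable_normed
  have hg1 : ∫ x, g x ∂μ = 1 := b.integral_normed
  have hgs : ∀ x, g x ≠ 0 → ‖x‖ < min δ 1 := by
    intro x hx
    have : x ∈ Function.support (b.normed μ) := hx
    rwa [b.support_normed_eq, mem_ball_zero_iff] at this
  obtain ⟨p, hp⟩ := exists_polynomialFunction_near g hBc
    (show 0 < ε / (4 * (M * μ.real B + 1)) by positivity)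
  refine ⟨_, weightedTranslates_mem_PVal Φ hs p μ, fun K hK => ?_⟩
  have hip := integrable_mul_translate Φ.1.continuous hs (polynomialFunction p) μ K
  have hig := integrable_mul_translate Φ.1.continuous hs gC μ K
  have hgc : Integrable (fun x => gC x * φ.1 K) μ := hgi.ofReal.mul_const _
  have hgφ : ∫ x, gC x * φ.1 K ∂μ = φ.1 K := by
    have : ∫ x, gC x ∂μ = 1 := by
      rw [← Complex.ofReal_one, ← hg1]
      exact integral_ofReal
    rw [integral_mul_const, this, one_mul]
  -- The error splits into replacing the bump by `p`, which matters only on `B`, and smoothing by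
  -- the bump.
  have hsplit : (weightedTranslates Φ hs (polynomialFunction p) μ).1 K - φ.1 K =
      (∫ x in B, (polynomialFunction p x - gC x) * Φ.1 (K.translate (-x)) ∂μ) +
        ∫ x, gC x * (Φ.1 (K.translate (-x)) - φ.1 K) ∂μ := by
    have h1 : ∫ x in B, (polynomialFunction p x - gC x) * Φ.1 (K.translate (-x)) ∂μ =
        ∫ x, (polynomialFunction p x - gC x) * Φ.1 (K.translate (-x)) ∂μ :=
      setIntegral_eq_integral_of_forall_compl_eq_zero fun x hx => by
        rw [hs.translate_eq_zero (hR K hK) hx, mul_zero]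
    rw [h1]
    simp only [sub_mul, mul_sub]
    rw [integral_sub hip hig, integral_sub hig hgc, hgφ, weightedTranslates_apply]
    ring
  have hfirst : ‖∫ x in B, (polynomialFunction p x - gC x) * Φ.1 (K.translate (-x)) ∂μ‖ ≤
      ε / 4 := by
    have hbd : ∀ x ∈ B, ‖(polynomialFunction p x - gC x) * Φ.1 (K.translate (-x))‖ ≤
        ε / (4 * (M * μ.real B + 1)) * M := by
      intro x hx
      rw [norm_mul]
      refine mul_le_mul (hp x hx).le (hM _ ?_) (norm_nonneg _) (by positivity)
      rintro _ ⟨z, hz, rfl⟩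
      have h1 := hR K hK hz
      simp only [hB, mem_closedBall, dist_zero_right] at h1 hx ⊢
      have := norm_add_le z (-x)
      rw [norm_neg] at this
      linarith
    refine (norm_setIntegral_le_of_norm_le_const hBc.measure_lt_top hbd).trans ?_
    rw [div_mul_eq_mul_div, div_mul_eq_mul_div, div_le_div_iff₀ (by positivity) (by positivity)]
    have : 0 ≤ M * μ.real B := by positivity
    nlinarith
  have hsecond : ‖∫ x, gC x * (Φ.1 (K.translate (-x)) - φ.1 K) ∂μ‖ ≤ ε / 4 := by
    have hbd : ∀ x, ‖gC x * (Φ.1 (K.translate (-x)) - φ.1 K)‖ ≤ g x * (ε / 4) := by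
      intro x
      have hgn : ‖gC x‖ = g x := by
        change ‖((g x : ℝ) : ℂ)‖ = g x
        rw [Complex.norm_real, Real.norm_of_nonneg (hg0 x)]
      rw [norm_mul, hgn]
      by_cases hx : g x = 0
      · simp [hx]
      · have hx' := lt_min_iff.1 (hgs x hx)
        refine mul_le_mul_of_nonneg_left ?_ (hg0 x)
        rw [cutoff_of_subset φ]
        · exact (hφδ x hx'.1 K hK).le
        · rintro _ ⟨z, hz, rfl⟩
          have h1 := hR K hK hz
          simp only [mem_closedBall, dist_zero_right] at h1 ⊢
          have := norm_add_le z (-x)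
          rw [norm_neg] at this
          linarith [hx'.2]
    refine (norm_integral_le_of_norm_le (hgi.mul_const _) (.of_forall hbd)).trans_eq ?_
    rw [integral_mul_const, hg1, one_mul]
  rw [hsplit]
  refine (norm_add_le _ _).trans_lt ?_
  linarith

end

theorem proposition1p1p2 (V : Type*) [NormedAddCommGroup V] [NormedSpace ℝ V]
    [FiniteDimensional ℝ V] :
    Dense (PVal V : Set (CVal V)) := by
  intro φ
  exact CVal.mem_closure_iff.2 fun S hS ε hε => exists_mem_PVal_near φ hS hε
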